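/- Let $\mathbf T=(T_1,T_2)$ be a commuting $2$-variable weighted shift on $\ell^2(\mathbb Z_+^2)$ with positive bounded weights $\alpha,\beta$, that is, $T_1e_{\mathbf k}=\alpha_{\mathbf k}e_{\mathbf k+(1,0)}$ and $T_2e_{\mathbf k}=\beta_{\mathbf k}e_{\mathbf k+(0,1)}$ for all $\mathbf k\in\mathbb Z_+^2$, and suppose that $\mathbf T$ belongs to the class $\mathcal{SFC}$ of symmetrically flat, contractive shifts with subnormal components: $\alpha_{(k_1,k_2)}=\beta_{(k_1,k_2)}=1$ for all $k_1,k_2\ge 1$, $\|T_1\|\le 1$, $\|T_2\|\le 1$, and each of $T_1,T_2$ is subnormal (the restriction of a normal operator to an invariant subspace). Put $x_n=\alpha_{(n,0)}$, $y_n=\beta_{(0,n)}$ $(n\ge 0)$ and $a=\alpha_{(0,1)}$. The Berger measure of a subnormal unilateral weighted shift $W=\mathrm{shift}(w_0,w_1,\dots)$ is the probability measure on $[0,\|W\|^2]$ whose $k$-th moment is $w_0^2\cdots w_{k-1}^2$ for every $k\ge 0$. Let $\xi$ be the Berger measure of $\mathrm{shift}(x_0,x_1,\dots)$, let $p=\xi(\{0\})$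 and $q=\xi(\{1\})$, and let $\eta_1$ be the Berger measure of $\mathrm{shift}(y_1,y_2,\dots)$. Then $\eta_1(\{0\})=0$, $\frac1t\in L^1(\eta_1)$ and $\left\|\frac1t\right\|_{L^1(\eta_1)}\ge a^2$, and $\mathbf T$ is subnormal (that is, $(T_1,T_2)$ is the restriction of a commuting pair of normal operators to a common invariant subspace) if and only if $$y_0\le s:=\min\left\{\sqrt{\frac{q}{a^2}},\ \sqrt{\frac{p}{\left\|\frac1t\right\|_{L^1(\eta_1)}-a^2}}\right\},$$ where the second entry of the minimum is read as $+\infty$ if $\left\|\frac1t\right\|_{L^1(\eta_1)}=a^2$. -/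

import Mathlib

open MeasureTheory

noncomputable section

namespace TwoVarShift

universe u

/-- A bounded operator `T` on a complex Hilbert space `H` is subnormal if it is the restriction of a
normal operator `N`, acting on a Hilbert space `K` that contains `H` (through the isometry `V`), to
the invariant subspace `H`. -/
def IsSubnormal {H : Type u} [NormedAddCommGroup H] [InnerProductSpace ℂ H] [CompleteSpace H]
    (T : H →L[ℂ] H) : Prop :=
  ∃ (K : Type u) (_ : NormedAddCommGroup K) (_ : InnerProductSpace ℂ K) (_ : CompleteSpace K)
    (V : H →ₗᵢ[ℂ] K) (N : K →L[ℂ] K),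
    IsStarNormal N ∧ ∀ h : H, N (V h) = V (T h)

/-- A pair `(T₁, T₂)` is (jointly) subnormal if it is the restriction of a commuting pair
`(N₁, N₂)` of normal operators to a common invariant subspace. -/
def IsJointlySubnormal {H : Type u} [NormedAddCommGroup H] [InnerProductSpace ℂ H]
    [CompleteSpace H] (T₁ T₂ : H →L[ℂ] H) : Prop :=
  ∃ (K : Type u) (_ : NormedAddCommGroup K) (_ : InnerProductSpace ℂ K) (_ : CompleteSpace K)
    (V : H →ₗᵢ[ℂ] K) (N₁ N₂ : K →L[ℂ] K),
    IsStarNormal N₁ ∧ IsStarNormal N₂ ∧ Commute N₁ N₂ ∧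
    (∀ h : H, N₁ (V h) = V (T₁ h)) ∧ (∀ h : H, N₂ (V h) = V (T₂ h))

/-- The Hilbert space `ℓ²(ℤ₊²)`. -/
abbrev ellTwo : Type := lp (fun _ : ℕ × ℕ => ℂ) 2

/-- The canonical orthonormal basis vector `e_k` of `ℓ²(ℤ₊²)`. -/
def e (k : ℕ × ℕ) : ellTwo := lp.single 2 k (1 : ℂ)

/-- `(T₁, T₂)` is the 2-variable weighted shift with positive weights `α`, `β`:
`T₁ e_k = α_k e_{k+ε₁}` and `T₂ e_k = β_k e_{k+ε₂}`. The weights are bounded because `T₁` and `T₂`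
are bounded operators, and the weights determine the operators by continuity. -/
structure IsShift (α β : ℕ × ℕ → ℝ) (T₁ T₂ : ellTwo →L[ℂ] ellTwo) : Prop where
  alpha_pos : ∀ k, 0 < α k
  beta_pos : ∀ k, 0 < β k
  map_fst : ∀ k, T₁ (e k) = (α k : ℂ) • e (k + (1, 0))
  map_snd : ∀ k, T₂ (e k) = (β k : ℂ) • e (k + (0, 1))

def IsHorizontallyFlat (α : ℕ × ℕ → ℝ) : Prop :=
  ∀ k₁ k₂ : ℕ, 1 ≤ k₁ → 1 ≤ k₂ → α (k₁, k₂) = α (1, 1)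

def IsVerticallyFlat (β : ℕ × ℕ → ℝ) : Prop :=
  ∀ k₁ k₂ : ℕ, 1 ≤ k₁ → 1 ≤ k₂ → β (k₁, k₂) = β (1, 1)

def IsSymmetricallyFlat (α β : ℕ × ℕ → ℝ) : Prop :=
  IsHorizontallyFlat α ∧ IsVerticallyFlat β ∧ α (1, 1) = β (1, 1)

/-- The class `SFC`: commuting, symmetrically flat, contractive 2-variable weighted shifts
(normalized by `α₁₁ = β₁₁ = 1`) with `T₁` and `T₂` subnormal. -/
structure SFC (α β : ℕ × ℕ → ℝ) (T₁ T₂ : ellTwo →L[ℂ] ellTwo) : Prop where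
  isShift : IsShift α β T₁ T₂
  commute : Commute T₁ T₂
  symmetricallyFlat : IsSymmetricallyFlat α β
  alpha_one_one : α (1, 1) = 1
  norm_fst_le : ‖T₁‖ ≤ 1
  norm_snd_le : ‖T₂‖ ≤ 1
  subnormal_fst : IsSubnormal T₁
  subnormal_snd : IsSubnormal T₂

/-- The moments `γ_k = w₀² ⋯ w_{k-1}²` of a weight sequence. -/
def moment (w : ℕ → ℝ) (k : ℕ) : ℝ := ∏ i ∈ Finset.range k, w i ^ 2

/-- `ξ` is the Berger measure of the unilateral weighted shift `W = shift(w₀, w₁, …)` with positive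
bounded weights: a Borel probability measure carried by `[0, ‖W‖²]`, where `‖W‖ = supₙ wₙ`, whose
moments are those of `w`. -/
structure IsBergerMeasure (w : ℕ → ℝ) (ξ : Measure ℝ) : Prop where
  isProbabilityMeasure : IsProbabilityMeasure ξ
  support : ξ (Set.Icc 0 ((⨆ n, w n) ^ 2))ᶜ = 0
  moments : ∀ k : ℕ, ∫ t, t ^ k ∂ξ = moment w k

/-- `‖1/t‖_{L¹(η)}` for a measure `η` on `[0, ∞)`. It is used only together with `η {0} = 0` and the
integrability of `1/t`. -/
def invNorm (η : Measure ℝ) : ℝ := ∫ t, ‖1 / t‖ ∂η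

/-- `s = min {√(q / a²), √(p / (‖1/t‖_{L¹(η₁)} - a²))}`, with `p = ξ({0})` and `q = ξ({1})`; the
second entry is `+∞` when its denominator vanishes. -/
def sBound (ξ η₁ : Measure ℝ) (a : ℝ) : EReal :=
  min ((Real.sqrt (ξ.real {1} / a ^ 2) : ℝ) : EReal)
    (if invNorm η₁ - a ^ 2 = 0 then ⊤
      else ((Real.sqrt (ξ.real {0} / (invNorm η₁ - a ^ 2)) : ℝ) : EReal))

end TwoVarShift

end

/-!
Commutativity and flatness determine the moments `γ k = ‖T₂^k₂ T₁^k₁ e₀‖²` of the shift: on the axes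
they are the moments of `ξ` and `y₀²` times those of `η₁`, and at every `k` with `k₁, k₂ ≥ 1` they
equal `c = y₀² a²` (`SFC.pathWeight_succ_succ`). Hence the only possible representing measure on the
unit square consists of an atom of mass `c` at `(1, 1)` and of a part carried by the coordinate
axes, namely `ξ - c δ₁` on the first axis and `y₀² (dη₁ / t - a² dδ₁)` on the second; what is left
for the origin is `p - y₀² (‖1/t‖ - a²)`. The atoms at `(1, 0)` and `(0, 1)` are nonnegative because
`T₁` and `T₂` are contractions, so that only the mass at the origin decides
(`SFC.isJointlySubnormal_iff`). In particular the condition `y₀² a² ≤ q` always holds.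

If that mass is nonnegative, the measure exists (`exists_measure_unitSquare`). Let `ν` be its
product with the Haar measures of two circles. The monomials `(√s z)^k₁ (√t w)^k₂` are orthogonal
in `L²(ν)`, and multiplication by `√s z` and by `√t w` is a commuting pair of normal operators
extending `(T₁, T₂)` (`isJointlySubnormal_of_measure`). The space is obtained as the
Gelfand-Naimark-Segal space of `f ↦ ∫ f dν` on continuous functions.

Conversely, no representing measure is needed. For a commuting normal extension `(N₁, N₂)` the
operators `A = N₁* N₁` and `B = N₂* N₂` commute by Fuglede's theorem. Although `A` and `B` need not
be contractions, `1 - A` acts on the vector `e₀` as a positive operator, since the powers of `A` are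
bounded there; the same holds for `B`. So the finite differences
`⟪(1 - A)ⁿ (1 - B)ᵐ e₀, e₀⟫` of the moments are nonnegative (`IsJointlySubnormal.sum_nonneg`).
They equal `∫ (1 - s)ⁿ dξ + c - y₀² ∫ ∑_{i < m} (1 - t)ⁱ dη₁`. As `n → ∞` the first integral tends
to `p`, and as `m → ∞` the second one tends to `‖1/t‖`, which gives `y₀² (‖1/t‖ - a²) ≤ p`. The same
argument for `T₂` alone bounds the second integral by `1 / y₀²`, and this yields `η₁ {0} = 0` and
the integrability of `1/t`.
-/

/-! ### Subnormality of a shift with a representing measure -/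

namespace TwoVarShift

open scoped ComplexOrder InnerProductSpace ComplexConjugate

lemma integrable_of_continuous {X E : Type*} [TopologicalSpace X] [CompactSpace X]
    [MeasurableSpace X] [BorelSpace X] [NormedAddCommGroup E] [SecondCountableTopology E]
    (ν : Measure X) [IsFiniteMeasure ν] {f : X → E} (hf : Continuous f) : Integrable f ν :=
  hf.integrable_of_hasCompactSupport (HasCompactSupport.of_compactSpace f)

/-- The positive linear functional `f ↦ ∫ f dν` on `C(X, ℂ)`. -/
noncomputable def integralFunctional {X : Type*} [TopologicalSpace X] [CompactSpace X]
    [MeasurableSpace X] [BorelSpace X] (ν : Measure X) [IsFiniteMeasure ν] : C(X, ℂ) →ₚ[ℂ] ℂ :=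
  PositiveLinearMap.mk₀
    { toFun := fun f => ∫ x, f x ∂ν
      map_add' := fun f g => integral_add (integrable_of_continuous ν f.continuous)
        (integrable_of_continuous ν g.continuous)
      map_smul' := fun c f => integral_const_mul c _ }
    fun f hf => by
      have h : ∀ x, f x = ((f x).re : ℂ) := fun x =>
        (Complex.eq_re_of_ofReal_le (r := 0) (by simpa using hf x))
      change (0 : ℂ) ≤ ∫ x, f x ∂ν
      rw [integral_congr_ae (Filter.Eventually.of_forall h), integral_complex_ofReal]
      exact Complex.zero_le_real.2 (integral_nonneg fun x => (Complex.le_def.1 (hf x)).1)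

lemma integralFunctional_apply {X : Type*} [TopologicalSpace X] [CompactSpace X]
    [MeasurableSpace X] [BorelSpace X] (ν : Measure X) [IsFiniteMeasure ν] (f : C(X, ℂ)) :
    integralFunctional ν f = ∫ x, f x ∂ν := rfl

lemma integral_fourier_eq_ite (n : ℤ) :
    ∫ z, (fourier n z : ℂ) ∂(AddCircle.haarAddCircle (T := 1)) = if n = 0 then 1 else 0 := by
  split_ifs with h
  · simp [h]
  · exact integral_eq_zero_of_add_right_eq_neg (fourier_add_half_inv_index h one_pos)

/-- Pairs of complex numbers of modulus at most one in polar coordinates: the point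
`((s, t), (z, w))` stands for `(√s z, √t w)`, where `z` and `w` are points of the unit circle. -/
abbrev PolarSpace : Type := (unitInterval × unitInterval) × (UnitAddCircle × UnitAddCircle)

/-- The first coordinate function `√s z`. -/
noncomputable def coordFst : C(PolarSpace, ℂ) where
  toFun x := ((√(x.1.1 : ℝ) : ℝ) : ℂ) * fourier 1 x.2.1
  continuous_toFun := by fun_prop

/-- The second coordinate function `√t w`. -/
noncomputable def coordSnd : C(PolarSpace, ℂ) where
  toFun x := ((√(x.1.2 : ℝ) : ℝ) : ℂ) * fourier 1 x.2.2
  continuous_toFun := by fun_prop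

lemma fourier_one_pow (k : ℕ) (z : UnitAddCircle) :
    (fourier 1 z : ℂ) ^ k = fourier (k : ℤ) z := by
  induction k with
  | zero => simp
  | succ k ih => rw [pow_succ, ih, Nat.cast_succ, fourier_add]

/-- The rotation-invariant measure on `PolarSpace` with radial part `μ`. -/
noncomputable def polarMeasure (μ : Measure (unitInterval × unitInterval)) : Measure PolarSpace :=
  μ.prod ((AddCircle.haarAddCircle (T := 1)).prod (AddCircle.haarAddCircle (T := 1)))

instance (μ : Measure (unitInterval × unitInterval)) [IsFiniteMeasure μ] :
    IsFiniteMeasure (polarMeasure μ) := by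
  unfold polarMeasure; infer_instance

/-- The monomials `(√s z)^k₁ (√t w)^k₂` are orthogonal for a rotation-invariant measure, and their
squared norms are the moments of the radial part. -/
lemma integral_star_monomial_mul_monomial (μ : Measure (unitInterval × unitInterval))
    [IsFiniteMeasure μ] (k l : ℕ × ℕ) :
    integralFunctional (polarMeasure μ)
      (star (coordFst ^ k.1 * coordSnd ^ k.2) * (coordFst ^ l.1 * coordSnd ^ l.2)) =
      if k = l then ((∫ x, (x.1 : ℝ) ^ k.1 * (x.2 : ℝ) ^ k.2 ∂μ : ℝ) : ℂ) else 0 := by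
  have h : ∀ x : PolarSpace,
      (star (coordFst ^ k.1 * coordSnd ^ k.2) * (coordFst ^ l.1 * coordSnd ^ l.2)) x =
      (((√(x.1.1 : ℝ)) ^ (k.1 + l.1) * (√(x.1.2 : ℝ)) ^ (k.2 + l.2) : ℝ) : ℂ) *
        (fourier ((l.1 : ℤ) - k.1) x.2.1 * fourier ((l.2 : ℤ) - k.2) x.2.2) := by
    intro x
    have hf : ∀ (i j : ℕ) (z : UnitAddCircle),
        (fourier ((j : ℤ) - i) z : ℂ) = conj ((fourier 1 z : ℂ) ^ i) * (fourier 1 z : ℂ) ^ j := by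
      intro i j z
      rw [fourier_one_pow, fourier_one_pow, ← fourier_neg, ← fourier_add]
      congr 2; ring
    rw [hf, hf]
    simp only [coordFst, coordSnd, ContinuousMap.mul_apply, ContinuousMap.star_apply,
      ContinuousMap.pow_apply, ContinuousMap.coe_mk, RCLike.star_def, map_mul, map_pow,
      Complex.conj_ofReal, Complex.ofReal_mul, Complex.ofReal_pow]
    ring
  rw [integralFunctional_apply, integral_congr_ae (Filter.Eventually.of_forall h), polarMeasure,
    integral_prod_mul (fun x : unitInterval × unitInterval =>
      (((√(x.1 : ℝ)) ^ (k.1 + l.1) * (√(x.2 : ℝ)) ^ (k.2 + l.2) : ℝ) : ℂ))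
      (fun z : UnitAddCircle × UnitAddCircle =>
        (fourier ((l.1 : ℤ) - k.1) z.1 * fourier ((l.2 : ℤ) - k.2) z.2 : ℂ)),
    integral_prod_mul (fun z : UnitAddCircle => (fourier ((l.1 : ℤ) - k.1) z : ℂ))
      (fun z : UnitAddCircle => (fourier ((l.2 : ℤ) - k.2) z : ℂ)),
    integral_fourier_eq_ite, integral_fourier_eq_ite]
  by_cases hkl : k = l
  · subst hkl
    simp only [sub_self, if_true, mul_one]
    rw [integral_complex_ofReal]
    congr 1
    refine integral_congr_ae (Filter.Eventually.of_forall fun x => ?_)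
    have : ∀ (u : unitInterval) (i : ℕ), √(u : ℝ) ^ (i + i) = (u : ℝ) ^ i := by
      intro u i
      rw [← two_mul, pow_mul, Real.sq_sqrt u.2.1]
    simp only [this]
  · rw [if_neg hkl]
    by_cases h1 : (l.1 : ℤ) - k.1 = 0
    · by_cases h2 : (l.2 : ℤ) - k.2 = 0
      · exact absurd (Prod.ext (by omega) (by omega)) hkl
      · simp [h2]
    · simp [h1]

/-- The easy half of the Berger theorem in two variables: a shift whose moments are represented by
a measure on the unit square is subnormal. It is a restriction of multiplication by the coordinate
functions in the space obtained from `C(PolarSpace, ℂ)` by completing for the `L²` seminorm of the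
rotation-invariant measure. -/
theorem isJointlySubnormal_of_measure {α β : ℕ × ℕ → ℝ} {T₁ T₂ : ellTwo →L[ℂ] ellTwo}
    (hT : IsShift α β T₁ T₂) (δ : ℕ × ℕ → ℝ) (hδ : ∀ k, 0 < δ k)
    (hδ₁ : ∀ k, δ (k + (1, 0)) = α k * δ k) (hδ₂ : ∀ k, δ (k + (0, 1)) = β k * δ k)
    (μ : Measure (unitInterval × unitInterval)) [IsFiniteMeasure μ]
    (hμ : ∀ k : ℕ × ℕ, ∫ x, (x.1 : ℝ) ^ k.1 * (x.2 : ℝ) ^ k.2 ∂μ = δ k ^ 2) :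
    IsJointlySubnormal T₁ T₂ := by
  set Φ := integralFunctional (polarMeasure μ) with hΦ
  set F : ℕ × ℕ → C(PolarSpace, ℂ) := fun k => coordFst ^ k.1 * coordSnd ^ k.2 with hF
  set v : ℕ × ℕ → Φ.GNS := fun k => ((δ k : ℂ)⁻¹) • ((Φ.toPreGNS (F k) : Φ.PreGNS) : Φ.GNS)
    with hv
  have hδ0 : ∀ k, (δ k : ℂ) ≠ 0 := fun k => by exact_mod_cast (hδ k).ne'
  have hortho : Orthonormal ℂ v := by
    rw [orthonormal_iff_ite]
    intro k l
    simp only [hv]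
    rw [inner_smul_left, inner_smul_right, UniformSpace.Completion.inner_coe,
      PositiveLinearMap.preGNS_inner_def, PositiveLinearMap.ofPreGNS_toPreGNS,
      PositiveLinearMap.ofPreGNS_toPreGNS, hF, hΦ, integral_star_monomial_mul_monomial, hμ]
    split_ifs with h
    · subst h
      have := hδ0 k
      simp
      field_simp
    · simp
  set V := hortho.orthogonalFamily.linearIsometry with hV
  have hVe : ∀ k, V (e k) = v k := by
    intro k
    rw [hV, e, OrthogonalFamily.linearIsometry_apply_single]
    simp
  have hmul : ∀ (g f : C(PolarSpace, ℂ)), Φ.gnsStarAlgHom g ((Φ.toPreGNS f : Φ.PreGNS) : Φ.GNS) =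
      ((Φ.toPreGNS (g * f) : Φ.PreGNS) : Φ.GNS) := by
    intro g f
    change Φ.gnsNonUnitalStarAlgHom g _ = _
    rw [PositiveLinearMap.gnsNonUnitalStarAlgHom_apply_coe]
    simp
  have hext : ∀ (N : Φ.GNS →L[ℂ] Φ.GNS) (T : ellTwo →L[ℂ] ellTwo),
      (∀ k, N (V (e k)) = V (T (e k))) → ∀ h, N (V h) = V (T h) := by
    intro N T hNT h
    have : N ∘L V.toContinuousLinearMap = V.toContinuousLinearMap ∘L T := by
      refine lp.ext_continuousLinearMap (by simp) fun k => ?_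
      ext
      simpa [e] using hNT k
    exact DFunLike.congr_fun this h
  have hcomm : ∀ f g, Commute (Φ.gnsStarAlgHom f) (Φ.gnsStarAlgHom g) := fun f g =>
    (Commute.all f g).map Φ.gnsStarAlgHom
  have hnormal : ∀ f, IsStarNormal (Φ.gnsStarAlgHom f) := fun f =>
    ⟨by rw [← map_star]; exact hcomm _ _⟩
  refine ⟨Φ.GNS, inferInstance, inferInstance, inferInstance, V, Φ.gnsStarAlgHom coordFst,
    Φ.gnsStarAlgHom coordSnd, hnormal _, hnormal _, hcomm _ _, hext _ _ fun k => ?_,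
    hext _ _ fun k => ?_⟩
  · rw [hT.map_fst, map_smul, hVe, hVe]
    simp only [hv, map_smul]
    have h1 : coordFst * F k = F (k + (1, 0)) := by
      simp only [hF, Prod.fst_add, Prod.snd_add]; ring
    have := hδ0 k
    have hα : (α k : ℂ) ≠ 0 := by exact_mod_cast (hT.alpha_pos k).ne'
    rw [hmul, h1, hδ₁, smul_smul]
    congr 1
    push_cast
    field_simp
  · rw [hT.map_snd, map_smul, hVe, hVe]
    simp only [hv, map_smul]
    have h1 : coordSnd * F k = F (k + (0, 1)) := by
      simp only [hF, Prod.fst_add, Prod.snd_add]; ring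
    have := hδ0 k
    have hβ : (β k : ℂ) ≠ 0 := by exact_mod_cast (hT.beta_pos k).ne'
    rw [hmul, h1, hδ₂, smul_smul]
    congr 1
    push_cast
    field_simp

end TwoVarShift

/-! ### Finite differences of the moments of a subnormal pair -/

namespace TwoVarShift
section Operator
open scoped InnerProductSpace

variable {K : Type*} [NormedAddCommGroup K] [InnerProductSpace ℂ K] [CompleteSpace K]

lemma apply_eq_zero_of_nonneg_of_re_inner_eq_zero {D : K →L[ℂ] K} (hD : 0 ≤ D) {u : K}
    (h : (⟪D u, u⟫_ℂ).re = 0) : D u = 0 := by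
  have hs : CFC.sqrt D * CFC.sqrt D = D := CFC.sqrt_mul_sqrt_self D
  have hsa : IsSelfAdjoint (CFC.sqrt D) := (CFC.sqrt_nonneg D).isSelfAdjoint
  have hu : CFC.sqrt D u = 0 := by
    rw [← norm_eq_zero, ← sq_eq_zero_iff, ← h, ← inner_self_eq_norm_sq (𝕜 := ℂ)]
    conv_rhs => rw [← hs]
    rw [mul_apply_eq_comp, ← ContinuousLinearMap.adjoint_inner_right,
      hsa.adjoint_eq]
    exact inner_re_symm (𝕜 := ℂ) _ _
  rw [← hs, mul_apply_eq_comp, hu, map_zero]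

/-- If the powers of a positive operator `A` are bounded at `u`, then `1 - A` agrees at `u` with its
positive part `P`. -/
lemma exists_nonneg_apply_eq_of_bounded_powers {A : K →L[ℂ] K} (hA : 0 ≤ A) {u : K} {C : ℝ}
    (hC : ∀ k : ℕ, (⟪(A ^ k) u, u⟫_ℂ).re ≤ C) :
    ∃ P : K →L[ℂ] K, 0 ≤ P ∧ (∀ B, Commute A B → Commute P B) ∧ P u = (1 - A) u := by
  have hsa : IsSelfAdjoint A := hA.isSelfAdjoint
  set D : K →L[ℂ] K := cfc (fun x : ℝ => max (x - 1) 0) A with hD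
  set P : K →L[ℂ] K := cfc (fun x : ℝ => max (1 - x) 0) A with hP
  have hD0 : 0 ≤ D := cfc_nonneg fun x _ => le_max_right _ _
  have hP0 : 0 ≤ P := cfc_nonneg fun x _ => le_max_right _ _
  have hPD : P - D = 1 - A := by
    rw [hP, hD, ← cfc_sub _ _ A]
    have : (1 : K →L[ℂ] K) - A = cfc (fun x : ℝ => 1 - x) A := by
      rw [cfc_sub _ _ A, cfc_const_one ℝ A, cfc_id' ℝ A]
    rw [this]
    refine cfc_congr fun x _ => ?_
    rcases le_total x 1 with h | h
    · simp [h]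
    · simp [h]
  -- Bernoulli's inequality gives `k (x - 1)⁺ ≤ xᵏ`, so the negative part `D` of `1 - A` kills `u`.
  have hDpow : ∀ k : ℕ, (k : ℝ) • D ≤ A ^ k := by
    intro k
    rw [hD, ← cfc_smul _ _ A, ← cfc_pow_id (R := ℝ) A k]
    refine cfc_mono fun x hx => ?_
    have hx0 : 0 ≤ x := spectrum_nonneg_of_nonneg hA hx
    have hb := one_add_mul_le_pow (a := x - 1) (by linarith) k
    simp only [add_sub_cancel] at hb
    rcases le_total x 1 with h | h
    · simp [h, pow_nonneg hx0]
    · simp only [smul_eq_mul, sub_nonneg, h, sup_of_le_left]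
      linarith
  have hDu : D u = 0 := by
    apply apply_eq_zero_of_nonneg_of_re_inner_eq_zero hD0
    have h0 : 0 ≤ (⟪D u, u⟫_ℂ).re :=
      ((ContinuousLinearMap.nonneg_iff_isPositive D).1 hD0).re_inner_nonneg_left u
    have hk : ∀ k : ℕ, (k : ℝ) * (⟪D u, u⟫_ℂ).re ≤ C := by
      intro k
      have := ((ContinuousLinearMap.le_def _ _).1 (hDpow k)).re_inner_nonneg_left u
      simp only [sub_apply, smul_apply,
        inner_sub_left, inner_smul_left_eq_smul, map_sub, RCLike.smul_re] at this
      have h2 := hC k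
      simp only [RCLike.re_to_complex] at this
      linarith
    by_contra hne
    obtain ⟨k, hk'⟩ := exists_nat_gt (C / (⟪D u, u⟫_ℂ).re)
    have hpos : 0 < (⟪D u, u⟫_ℂ).re := lt_of_le_of_ne h0 (Ne.symm hne)
    rw [div_lt_iff₀ hpos] at hk'
    linarith [hk k]
  refine ⟨P, hP0, fun B hB => hB.cfc_real _, ?_⟩
  rw [← hPD, sub_apply, hDu, sub_zero]

omit [CompleteSpace K] in
lemma pow_apply_eq_of_commute {P Q : K →L[ℂ] K} (h : Commute P Q) {u : K} (hu : P u = Q u)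
    (n : ℕ) : (P ^ n) u = (Q ^ n) u := by
  induction n with
  | zero => rfl
  | succ n ih =>
    rw [pow_succ', mul_apply_eq_comp, ih, ← mul_apply_eq_comp,
      (h.pow_right n).eq, mul_apply_eq_comp, hu, pow_succ,
      mul_apply_eq_comp]

/-- Replacing `1 - A` and `1 - B` by their positive parts turns the product into a product of
commuting positive operators without changing its value at `u`. -/
lemma re_inner_one_sub_pow_mul_one_sub_pow_nonneg {A B : K →L[ℂ] K} (hA : 0 ≤ A) (hB : 0 ≤ B)
    (hAB : Commute A B) {u : K} {C : ℝ} (hCA : ∀ k : ℕ, (⟪(A ^ k) u, u⟫_ℂ).re ≤ C)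
    (hCB : ∀ k : ℕ, (⟪(B ^ k) u, u⟫_ℂ).re ≤ C) (n m : ℕ) :
    0 ≤ (⟪((1 - A) ^ n * (1 - B) ^ m) u, u⟫_ℂ).re := by
  obtain ⟨P, hP0, hPc, hPu⟩ := exists_nonneg_apply_eq_of_bounded_powers hA hCA
  obtain ⟨Q, hQ0, hQc, hQu⟩ := exists_nonneg_apply_eq_of_bounded_powers hB hCB
  have hPA : Commute P (1 - A) := (Commute.one_right P).sub_right (hPc A rfl)
  have hQB : Commute Q (1 - B) := (Commute.one_right Q).sub_right (hQc B rfl)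
  have hQA : Commute Q (1 - A) := (Commute.one_right Q).sub_right (hQc A hAB.symm)
  have hPQ : Commute P Q := hPc Q (hQc A hAB.symm).symm
  have h : ((1 - A) ^ n * (1 - B) ^ m) u = (P ^ n * Q ^ m) u := by
    rw [mul_apply_eq_comp, ← pow_apply_eq_of_commute hQB hQu,
      ← mul_apply_eq_comp, ((hQA.pow_right n).pow_left m).symm.eq,
      mul_apply_eq_comp, ← pow_apply_eq_of_commute hPA hPu,
      ← mul_apply_eq_comp, ((hPQ.pow_left n).pow_right m).eq]
  rw [h]
  have hpow : ∀ {R : K →L[ℂ] K}, 0 ≤ R → ∀ i : ℕ, 0 ≤ R ^ i := by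
    intro R hR i
    exact CStarAlgebra.pow_nonneg hR i
  exact ((ContinuousLinearMap.nonneg_iff_isPositive _).1
    (Commute.mul_nonneg (hpow hP0 n) (hpow hQ0 m)
      ((hPQ.pow_left n).pow_right m))).re_inner_nonneg_left u

lemma one_sub_pow_eq_sum {R : Type*} [Ring R] (A : R) (n : ℕ) :
    (1 - A) ^ n = ∑ i ∈ Finset.range (n + 1), ((-1) ^ i * (n.choose i : ℤ)) • A ^ i := by
  rw [sub_eq_neg_add, (Commute.one_right (-A)).add_pow]
  refine Finset.sum_congr rfl fun i _ => ?_
  rw [one_pow, mul_one, neg_pow, zsmul_eq_mul]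
  push_cast
  rw [mul_assoc, mul_assoc, (Nat.cast_commute _ _).eq]

/-- Positivity of `∫ (1 - s)ⁿ (1 - t)ᵐ` for the moments of a jointly subnormal pair of
contractions, written as a finite difference of the moments. -/
theorem IsJointlySubnormal.sum_nonneg {H : Type*} [NormedAddCommGroup H] [InnerProductSpace ℂ H]
    [CompleteSpace H] {T₁ T₂ : H →L[ℂ] H} (h : IsJointlySubnormal T₁ T₂) (h₁ : ‖T₁‖ ≤ 1)
    (h₂ : ‖T₂‖ ≤ 1) (u : H) (n m : ℕ) :
    0 ≤ ∑ i ∈ Finset.range (n + 1), ∑ j ∈ Finset.range (m + 1),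
      ((-1) ^ i * (n.choose i : ℝ)) * ((-1) ^ j * (m.choose j : ℝ)) *
        ‖(T₂ ^ j) ((T₁ ^ i) u)‖ ^ 2 := by
  obtain ⟨K, _, _, _, V, N₁, N₂, hN₁, hN₂, hN, hV₁, hV₂⟩ := h
  have hpow : ∀ {T : H →L[ℂ] H} {N : K →L[ℂ] K}, (∀ h, N (V h) = V (T h)) →
      ∀ (i : ℕ) h, (N ^ i) (V h) = V ((T ^ i) h) := by
    intro T N hTN i
    induction i with
    | zero => intro h; rfl
    | succ i ih => intro h; rw [pow_succ, mul_apply_eq_comp, hTN, ih, pow_succ, mul_apply_eq_comp]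
  have hs12 : Commute (star N₁) N₂ := hN₁.commute_star_left hN
  have hs21 : Commute N₁ (star N₂) := hN₂.commute_star_right hN
  have hss : Commute (star N₁) (star N₂) := hN.star_star
  have hn1 : Commute (star N₁) N₁ := hN₁.star_comm_self
  have hn2 : Commute (star N₂) N₂ := hN₂.star_comm_self
  set A := star N₁ * N₁ with hA
  set B := star N₂ * N₂ with hB
  have hA0 : 0 ≤ A := star_mul_self_nonneg N₁
  have hB0 : 0 ≤ B := star_mul_self_nonneg N₂
  have hAB : Commute A B := (hss.mul_right hs12).mul_left (hs21.mul_right hN)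
  have hmom : ∀ i j : ℕ, (⟪(A ^ i * B ^ j) (V u), V u⟫_ℂ).re = ‖(T₂ ^ j) ((T₁ ^ i) u)‖ ^ 2 := by
    intro i j
    have h1 : A ^ i * B ^ j = star (N₂ ^ j * N₁ ^ i) * (N₂ ^ j * N₁ ^ i) := by
      rw [hA, hB, hn1.mul_pow, hn2.mul_pow, star_mul, star_pow, star_pow]
      have e1 : Commute (N₁ ^ i) (star N₂ ^ j * N₂ ^ j) :=
        ((hs21.pow_left i).pow_right j).mul_right ((hN.pow_left i).pow_right j)
      rw [mul_assoc, e1.eq, mul_assoc, mul_assoc]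
    rw [h1, mul_apply_eq_comp, ContinuousLinearMap.star_eq_adjoint,
      ContinuousLinearMap.adjoint_inner_left, mul_apply_eq_comp, hpow hV₁, hpow hV₂,
      ← V.norm_map ((T₂ ^ j) ((T₁ ^ i) u)), ← inner_self_eq_norm_sq (𝕜 := ℂ)]
    rfl
  have hcontr : ∀ {T : H →L[ℂ] H}, ‖T‖ ≤ 1 → ∀ i : ℕ, ‖(T ^ i) u‖ ^ 2 ≤ ‖u‖ ^ 2 := by
    intro T hT i
    gcongr
    induction i with
    | zero => exact le_rfl
    | succ i ih =>
      rw [pow_succ', mul_apply_eq_comp]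
      exact (T.le_of_opNorm_le hT _).trans (by rwa [one_mul])
  have hfin := re_inner_one_sub_pow_mul_one_sub_pow_nonneg hA0 hB0 hAB (u := V u) (C := ‖u‖ ^ 2)
    (fun k => by simpa using (hmom k 0).le.trans (hcontr h₁ k))
    (fun k => by simpa using (hmom 0 k).le.trans (hcontr h₂ k)) n m
  refine hfin.trans_eq ?_
  rw [one_sub_pow_eq_sum, one_sub_pow_eq_sum, Finset.sum_mul_sum]
  simp only [sum_apply, sum_inner, Complex.re_sum]
  refine Finset.sum_congr rfl fun i _ => Finset.sum_congr rfl fun j _ => ?_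
  rw [smul_mul_smul_comm, ← hmom, ← Int.cast_smul_eq_zsmul ℝ, smul_apply,
    inner_smul_left_eq_smul, Complex.smul_re, smul_eq_mul]
  push_cast
  ring

/-- A subnormal operator `T` gives the jointly subnormal pair `(1, T)`. -/
lemma IsSubnormal.isJointlySubnormal_one {H : Type*} [NormedAddCommGroup H]
    [InnerProductSpace ℂ H] [CompleteSpace H] {T : H →L[ℂ] H} (h : IsSubnormal T) :
    IsJointlySubnormal 1 T := by
  obtain ⟨K, _, _, _, V, N, hN, hV⟩ := h
  exact ⟨K, inferInstance, inferInstance, inferInstance, V, 1, N, inferInstance, hN,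
    Commute.one_left N, fun _ => rfl, hV⟩

end Operator
end TwoVarShift

/-! ### Measures on the unit interval -/

namespace TwoVarShift
open Filter Topology

lemma tendsto_integral_pow (ν : Measure unitInterval) [IsFiniteMeasure ν] :
    Tendsto (fun k : ℕ => ∫ t, (t : ℝ) ^ k ∂ν) atTop (𝓝 (ν.real {1})) := by
  have h1 : ν.real {1} = ∫ t, ({1} : Set unitInterval).indicator (fun _ => (1 : ℝ)) t ∂ν := by
    rw [integral_indicator (measurableSet_singleton _)]; simp [Measure.real]
  rw [h1]
  refine tendsto_integral_of_dominated_convergence (fun _ => (1 : ℝ)) (fun k => ?_)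
    (integrable_const _) (fun k => ?_) ?_
  · exact Continuous.aestronglyMeasurable (by fun_prop)
  · refine Eventually.of_forall fun t => ?_
    rw [Real.norm_of_nonneg (pow_nonneg t.2.1 k)]
    exact pow_le_one₀ t.2.1 t.2.2
  · refine Eventually.of_forall fun t => ?_
    by_cases ht : t = 1
    · simp [ht]
    · rw [Set.indicator_of_notMem (by simpa using ht)]
      refine tendsto_pow_atTop_nhds_zero_of_lt_one t.2.1 (lt_of_le_of_ne t.2.2 fun h => ht ?_)
      exact Subtype.ext h

lemma tendsto_integral_one_sub_pow (ν : Measure unitInterval) [IsFiniteMeasure ν] :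
    Tendsto (fun k : ℕ => ∫ t, (1 - (t : ℝ)) ^ k ∂ν) atTop (𝓝 (ν.real {0})) := by
  have h := tendsto_integral_pow (ν.map unitInterval.symm)
  have hm : Measurable unitInterval.symm := unitInterval.continuous_symm.measurable
  rw [map_measureReal_apply hm (measurableSet_singleton _)] at h
  have h2 : unitInterval.symm ⁻¹' {1} = {0} := by
    ext t; simp [unitInterval.symm_eq_one]
  rw [h2] at h
  refine h.congr fun k => ?_
  rw [integral_map hm.aemeasurable (Continuous.aestronglyMeasurable (by fun_prop))]
  simp

/-- The partial sums `∑ (1 - t)ⁱ` increase to `1 / t`, so a uniform bound on their integrals bounds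
the integral of `1 / t`; at `t = 0` they tend to infinity, so `0` carries no mass. -/
lemma invNorm_of_bounded_geometric_sums (ν : Measure unitInterval) [IsFiniteMeasure ν] {C : ℝ}
    (hC : ∀ m : ℕ, ∫ t, ∑ i ∈ Finset.range m, (1 - (t : ℝ)) ^ i ∂ν ≤ C) :
    ν {0} = 0 ∧ Integrable (fun t : unitInterval => 1 / (t : ℝ)) ν ∧
      ∫ t, 1 / (t : ℝ) ∂ν ≤ C := by
  have hint : ∀ i : ℕ, Integrable (fun t : unitInterval => (1 - (t : ℝ)) ^ i) ν := fun i =>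
    integrable_of_continuous ν (by fun_prop)
  have hgeom : ∀ t : unitInterval,
      (ENNReal.ofReal (t : ℝ))⁻¹ = ∑' i : ℕ, ENNReal.ofReal ((1 - (t : ℝ)) ^ i) := by
    intro t
    have h0 : 0 ≤ 1 - (t : ℝ) := sub_nonneg.2 t.2.2
    simp_rw [ENNReal.ofReal_pow h0]
    rw [ENNReal.tsum_geometric, ← ENNReal.ofReal_one, ← ENNReal.ofReal_sub _ h0, sub_sub_cancel]
  have hC0 : 0 ≤ C := by simpa using hC 0
  have hlint : ∫⁻ t : unitInterval, (ENNReal.ofReal (t : ℝ))⁻¹ ∂ν ≤ ENNReal.ofReal C := by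
    simp_rw [hgeom]
    rw [lintegral_tsum fun i => by fun_prop]
    refine ENNReal.tsum_le_of_sum_range_le fun m => ?_
    have h1 : ∀ i : ℕ, ∫⁻ t : unitInterval, ENNReal.ofReal ((1 - (t : ℝ)) ^ i) ∂ν =
        ENNReal.ofReal (∫ t, (1 - (t : ℝ)) ^ i ∂ν) := fun i =>
      (ofReal_integral_eq_lintegral_ofReal (hint i)
        (Eventually.of_forall fun t => pow_nonneg (sub_nonneg.2 t.2.2) i)).symm
    simp_rw [h1]
    rw [← ENNReal.ofReal_sum_of_nonneg fun i _ =>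
      integral_nonneg fun t => pow_nonneg (sub_nonneg.2 t.2.2) i,
      ← integral_finsetSum _ fun i _ => hint i]
    exact ENNReal.ofReal_le_ofReal (hC m)
  have hmeas : Measurable fun t : unitInterval => (ENNReal.ofReal (t : ℝ))⁻¹ := by fun_prop
  have hpos : ∀ᵐ t : unitInterval ∂ν, 0 < (t : ℝ) := by
    filter_upwards [ae_lt_top hmeas (hlint.trans_lt ENNReal.ofReal_lt_top).ne] with t ht
    simpa using ht
  have heq : ∫⁻ t : unitInterval, ENNReal.ofReal (1 / (t : ℝ)) ∂ν =
      ∫⁻ t : unitInterval, (ENNReal.ofReal (t : ℝ))⁻¹ ∂ν := by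
    refine lintegral_congr_ae ?_
    filter_upwards [hpos] with t ht
    rw [one_div, ENNReal.ofReal_inv_of_pos ht]
  have hnn : ∀ t : unitInterval, 0 ≤ 1 / (t : ℝ) := fun t => one_div_nonneg.2 t.2.1
  have hm : AEStronglyMeasurable (fun t : unitInterval => 1 / (t : ℝ)) ν :=
    Measurable.aestronglyMeasurable (by fun_prop)
  refine ⟨?_, ⟨hm, ?_⟩, ?_⟩
  · refine measure_mono_null ?_ (ae_iff.1 hpos)
    rintro t rfl
    simp
  · rw [hasFiniteIntegral_iff_ofReal (Eventually.of_forall hnn), heq]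
    exact hlint.trans_lt ENNReal.ofReal_lt_top
  · rw [integral_eq_lintegral_of_nonneg_ae (Eventually.of_forall hnn) hm, heq]
    exact ENNReal.toReal_le_of_le_ofReal hC0 hlint

/-- A measure carried by `[0, 1]` is the image of a measure on the unit interval. -/
lemma exists_map_coe_eq (ν : Measure ℝ) [IsProbabilityMeasure ν]
    (h : ν (Set.Icc (0 : ℝ) 1)ᶜ = 0) :
    ∃ ν' : Measure unitInterval, IsProbabilityMeasure ν' ∧ ν'.map (↑) = ν := by
  have hmap : (ν.comap ((↑) : unitInterval → ℝ)).map (↑) = ν := by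
    rw [unitInterval, map_comap_subtype_coe measurableSet_Icc]
    exact Measure.restrict_eq_self_of_ae_mem (mem_ae_iff.2 h)
  refine ⟨_, ?_, hmap⟩
  have : IsProbabilityMeasure ((ν.comap ((↑) : unitInterval → ℝ)).map ((↑) : unitInterval → ℝ)) := by
    rw [hmap]; infer_instance
  exact Measure.isProbabilityMeasure_of_map ((↑) : unitInterval → ℝ)

end TwoVarShift

/-! ### Moments of flat weighted shifts -/

namespace TwoVarShift

lemma norm_e (k : ℕ × ℕ) : ‖e k‖ = 1 := by
  rw [e, lp.norm_single (by norm_num)]; simp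

/-- The product of the weights along the path `(0,0) → (k₁,0) → (k₁,k₂)`. Its square is the moment
of order `k` of the shift. -/
noncomputable def pathWeight (α β : ℕ × ℕ → ℝ) (k : ℕ × ℕ) : ℝ :=
  (∏ i ∈ Finset.range k.1, α (i, 0)) * ∏ j ∈ Finset.range k.2, β (k.1, j)

lemma pathWeight_snd_succ (α β : ℕ × ℕ → ℝ) (k : ℕ × ℕ) :
    pathWeight α β (k + (0, 1)) = β k * pathWeight α β k := by
  obtain ⟨i, j⟩ := k
  simp only [pathWeight, Prod.mk_add_mk, add_zero, Finset.prod_range_succ]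
  ring

lemma pathWeight_zero_snd (α β : ℕ × ℕ → ℝ) (i : ℕ) :
    pathWeight α β (i, 0) ^ 2 = moment (fun n => α (n, 0)) i := by
  simp [pathWeight, moment, Finset.prod_pow]

lemma pathWeight_zero_fst_succ (α β : ℕ × ℕ → ℝ) (j : ℕ) :
    pathWeight α β (0, j + 1) ^ 2 = β (0, 0) ^ 2 * moment (fun n => β (0, n + 1)) j := by
  simp [pathWeight, moment, Finset.prod_pow, Finset.prod_range_succ', mul_pow, mul_comm]

namespace IsShift

variable {α β : ℕ × ℕ → ℝ} {T₁ T₂ : ellTwo →L[ℂ] ellTwo}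

lemma alpha_le_norm (hT : IsShift α β T₁ T₂) (k : ℕ × ℕ) : α k ≤ ‖T₁‖ := by
  have h := T₁.le_opNorm (e k)
  rwa [hT.map_fst, norm_smul, norm_e, norm_e, mul_one, mul_one, Complex.norm_real,
    Real.norm_of_nonneg (hT.alpha_pos k).le] at h

lemma beta_le_norm (hT : IsShift α β T₁ T₂) (k : ℕ × ℕ) : β k ≤ ‖T₂‖ := by
  have h := T₂.le_opNorm (e k)
  rwa [hT.map_snd, norm_smul, norm_e, norm_e, mul_one, mul_one, Complex.norm_real,
    Real.norm_of_nonneg (hT.beta_pos k).le] at h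

/-- For weighted shifts, commutativity is a relation between the weights of each unit square. -/
lemma alpha_mul_beta (hT : IsShift α β T₁ T₂) (hc : Commute T₁ T₂) (k : ℕ × ℕ) :
    α (k + (0, 1)) * β k = β (k + (1, 0)) * α k := by
  have h := DFunLike.congr_fun hc.eq (e k)
  simp only [mul_apply_eq_comp, hT.map_fst, hT.map_snd, map_smul, smul_smul] at h
  rw [add_right_comm k (0, 1) (1, 0)] at h
  have he : e (k + (1, 0) + (0, 1)) ≠ 0 := by
    rw [← norm_ne_zero_iff, norm_e]; exact one_ne_zero
  have h2 := smul_left_injective ℂ he h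
  have h3 : β k * α (k + (0, 1)) = α k * β (k + (1, 0)) := by exact_mod_cast h2
  linarith

lemma pathWeight_pos (hT : IsShift α β T₁ T₂) (k : ℕ × ℕ) : 0 < pathWeight α β k :=
  mul_pos (Finset.prod_pos fun _ _ => hT.alpha_pos _) (Finset.prod_pos fun _ _ => hT.beta_pos _)

lemma pathWeight_fst_succ (hT : IsShift α β T₁ T₂) (hc : Commute T₁ T₂) (k : ℕ × ℕ) :
    pathWeight α β (k + (1, 0)) = α k * pathWeight α β k := by
  obtain ⟨i, j⟩ := k
  induction j with
  | zero => simp [pathWeight, Finset.prod_range_succ, mul_comm]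
  | succ j ih =>
    have h1 := pathWeight_snd_succ α β (i + 1, j)
    have h2 := pathWeight_snd_succ α β (i, j)
    have h3 := hT.alpha_mul_beta hc (i, j)
    simp only [Prod.mk_add_mk, add_zero] at h1 h2 h3 ih ⊢
    rw [h1, ih, h2, ← mul_assoc, ← mul_assoc, h3]

lemma pow_apply_e (hT : IsShift α β T₁ T₂) (i j : ℕ) :
    (T₂ ^ j) ((T₁ ^ i) (e (0, 0))) = (pathWeight α β (i, j) : ℂ) • e (i, j) := by
  induction j with
  | zero =>
    induction i with
    | zero => simp [pathWeight]
    | succ i ih =>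
      simp only [pow_zero, one_apply_eq_self] at ih ⊢
      rw [pow_succ', mul_apply_eq_comp, ih, map_smul, hT.map_fst, smul_smul]
      simp [pathWeight, Finset.prod_range_succ]
  | succ j ih =>
    rw [pow_succ', mul_apply_eq_comp, ih, map_smul, hT.map_snd, smul_smul]
    have h := pathWeight_snd_succ α β (i, j)
    simp only [Prod.mk_add_mk, add_zero] at h ⊢
    rw [h, mul_comm]
    push_cast
    rfl

lemma norm_pow_apply_e (hT : IsShift α β T₁ T₂) (i j : ℕ) :
    ‖(T₂ ^ j) ((T₁ ^ i) (e (0, 0)))‖ = pathWeight α β (i, j) := by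
  rw [hT.pow_apply_e, norm_smul, norm_e, mul_one, Complex.norm_real,
    Real.norm_of_nonneg (hT.pathWeight_pos _).le]

end IsShift

namespace SFC

variable {α β : ℕ × ℕ → ℝ} {T₁ T₂ : ellTwo →L[ℂ] ellTwo}

lemma alpha_eq_one (hT : SFC α β T₁ T₂) (i j : ℕ) : α (i + 1, j + 1) = 1 := by
  rw [hT.symmetricallyFlat.1 _ _ (by omega) (by omega), hT.alpha_one_one]

lemma beta_eq_one (hT : SFC α β T₁ T₂) (i j : ℕ) : β (i + 1, j + 1) = 1 := by
  rw [hT.symmetricallyFlat.2.1 _ _ (by omega) (by omega), ← hT.symmetricallyFlat.2.2,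
    hT.alpha_one_one]

/-- Flatness makes all the moments off the coordinate axes equal. -/
lemma pathWeight_succ_succ (hT : SFC α β T₁ T₂) (i j : ℕ) :
    pathWeight α β (i + 1, j + 1) = α (0, 1) * β (0, 0) := by
  induction j with
  | zero =>
    induction i with
    | zero =>
      have h := hT.isShift.pathWeight_fst_succ hT.commute (0, 1)
      simp only [Prod.mk_add_mk, add_zero, zero_add] at h ⊢
      rw [h]; simp [pathWeight]
    | succ i ih =>
      have h := hT.isShift.pathWeight_fst_succ hT.commute (i + 1, 1)
      simp only [Prod.mk_add_mk, add_zero, zero_add] at h ih ⊢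
      rw [h, ih, hT.alpha_eq_one i 0, one_mul]
  | succ j ih =>
    have h := pathWeight_snd_succ α β (i + 1, j + 1)
    simp only [Prod.mk_add_mk, add_zero] at h
    rw [h, ih, hT.beta_eq_one, one_mul]

/-- `T₂` is a contraction, so the moments decrease along the columns; compare rows `0` and `1`. -/
lemma mul_sq_le_moment_row (hT : SFC α β T₁ T₂) (k : ℕ) :
    β (0, 0) ^ 2 * α (0, 1) ^ 2 ≤ moment (fun n => α (n, 0)) (k + 1) := by
  have h := pathWeight_snd_succ α β (k + 1, 0)
  simp only [Prod.mk_add_mk, add_zero] at h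
  rw [hT.pathWeight_succ_succ k 0] at h
  rw [← pathWeight_zero_snd α β, ← mul_pow, mul_comm, h]
  have h1 : β (k + 1, 0) ≤ 1 := (hT.isShift.beta_le_norm _).trans hT.norm_snd_le
  have h2 := (hT.isShift.pathWeight_pos (k + 1, 0)).le
  have h3 := (hT.isShift.beta_pos (k + 1, 0)).le
  gcongr
  exact mul_le_of_le_one_left h2 h1

/-- `T₁` is a contraction, so the moments decrease along the rows; compare columns `0` and `1`. -/
lemma sq_le_moment_column (hT : SFC α β T₁ T₂) (k : ℕ) :
    α (0, 1) ^ 2 ≤ moment (fun n => β (0, n + 1)) k := by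
  have h := hT.isShift.pathWeight_fst_succ hT.commute (0, k + 1)
  simp only [Prod.mk_add_mk, add_zero] at h
  rw [hT.pathWeight_succ_succ 0 k] at h
  have hb := hT.isShift.beta_pos (0, 0)
  refine le_of_mul_le_mul_left ?_ (pow_pos hb 2)
  rw [← pathWeight_zero_fst_succ α β, ← mul_pow, mul_comm, h]
  have h1 : α (0, k + 1) ≤ 1 := (hT.isShift.alpha_le_norm _).trans hT.norm_fst_le
  have h2 := (hT.isShift.pathWeight_pos (0, k + 1)).le
  have h3 := (hT.isShift.alpha_pos (0, k + 1)).le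
  gcongr
  exact mul_le_of_le_one_left h2 h1

end SFC

lemma IsBergerMeasure.compl_unitInterval {w : ℕ → ℝ} {ν : Measure ℝ} (h : IsBergerMeasure w ν)
    (h0 : ∀ n, 0 ≤ w n) (h1 : ∀ n, w n ≤ 1) : ν (Set.Icc (0 : ℝ) 1)ᶜ = 0 := by
  refine measure_mono_null (Set.compl_subset_compl.2 (Set.Icc_subset_Icc_right ?_)) h.support
  exact pow_le_one₀ (Real.iSup_nonneg h0) (ciSup_le h1)

/-! ### The measure on the unit square -/

/-- The measure on the unit square with marginal `ξ` on the first coordinate whose part off the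
first coordinate axis consists of an atom of mass `b A` at `(1, 1)` and of the measure
`b (dη / t - A dδ₁)` on the second coordinate axis. The hypotheses make every part nonnegative:
`b (∫ 1/t dη - A) ≤ ξ {0}` is the one for the atom at the origin. -/
lemma exists_measure_unitSquare (ξ η : Measure unitInterval) [IsFiniteMeasure ξ]
    [IsFiniteMeasure η] {b A : ℝ} (hb : 0 ≤ b) (hA : 0 ≤ A) (hq : b * A ≤ ξ.real {1})
    (hη : A ≤ η.real {1}) (hint : Integrable (fun t : unitInterval => 1 / (t : ℝ)) η)
    (hp : b * (∫ t, 1 / (t : ℝ) ∂η - A) ≤ ξ.real {0}) :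
    ∃ μ : Measure (unitInterval × unitInterval), IsFiniteMeasure μ ∧
      ∀ f : unitInterval × unitInterval → ℝ, Continuous f →
        ∫ x, f x ∂μ = ∫ s, f (s, 0) ∂ξ + b * ∫ t, (f (0, t) - f (0, 0)) * (1 / (t : ℝ)) ∂η +
          b * A * (f (1, 1) - f (1, 0) - f (0, 1) + f (0, 0)) := by
  set ξ' := ξ.restrict {0, 1}ᶜ with hξ'
  set η' := (η.restrict {1}ᶜ).withDensity (fun t => ENNReal.ofReal (b * (1 / (t : ℝ)))) with hη'
  have hfin : IsFiniteMeasure η' :=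
    isFiniteMeasure_withDensity_ofReal (hint.const_mul b).restrict.2
  have hm₁ : Measurable fun s : unitInterval => (s, (0 : unitInterval)) := by fun_prop
  have hm₂ : Measurable fun t : unitInterval => ((0 : unitInterval), t) := by fun_prop
  refine ⟨ξ'.map (fun s => (s, 0)) + η'.map (fun t => (0, t)) +
    (ENNReal.ofReal (ξ.real {1} - b * A) • Measure.dirac (1, 0) +
      ENNReal.ofReal (b * (η.real {1} - A)) • Measure.dirac (0, 1) +
      ENNReal.ofReal (b * A) • Measure.dirac (1, 1) +
      ENNReal.ofReal (ξ.real {0} - b * (∫ t, 1 / (t : ℝ) ∂η - A)) • Measure.dirac (0, 0)),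
    ?_, fun f hf => ?_⟩
  · have hd : ∀ (r : ℝ) (x : unitInterval × unitInterval),
        IsFiniteMeasure (ENNReal.ofReal r • Measure.dirac x) := fun r x =>
      Measure.smul_finite _ ENNReal.ofReal_ne_top
    have := hd (ξ.real {1} - b * A) (1, 0)
    have := hd (b * (η.real {1} - A)) (0, 1)
    have := hd (b * A) (1, 1)
    have := hd (ξ.real {0} - b * (∫ t, 1 / (t : ℝ) ∂η - A)) (0, 0)
    infer_instance
  have hi : ∀ (ν : Measure (unitInterval × unitInterval)) [IsFiniteMeasure ν], Integrable f ν :=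
    fun ν _ => integrable_of_continuous ν hf
  have hid : ∀ (r : ℝ) (x : unitInterval × unitInterval),
      Integrable f (ENNReal.ofReal r • Measure.dirac x) := fun r x =>
    (hi _).smul_measure ENNReal.ofReal_ne_top
  have hdirac : ∀ {r : ℝ} (x : unitInterval × unitInterval), 0 ≤ r →
      ∫ y, f y ∂(ENNReal.ofReal r • Measure.dirac x) = r * f x := by
    intro r x hr
    rw [integral_smul_measure, integral_dirac, ENNReal.toReal_ofReal hr, smul_eq_mul]
  have hg : Continuous fun s : unitInterval => f (s, 0) := by fun_prop
  have hh : Continuous fun t : unitInterval => f (0, t) := by fun_prop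
  have hgi := integrable_of_continuous ξ hg
  obtain ⟨M, hM⟩ := isCompact_univ.exists_bound_of_continuousOn hh.continuousOn
  have hhi : Integrable (fun t : unitInterval => f (0, t) * (1 / (t : ℝ))) η :=
    hint.bdd_mul hh.aestronglyMeasurable (Filter.Eventually.of_forall fun t => hM t trivial)
  have e1 : ∫ s in ({0, 1} : Set unitInterval)ᶜ, f (s, 0) ∂ξ =
      ∫ s, f (s, 0) ∂ξ - ξ.real {0} * f (0, 0) - ξ.real {1} * f (1, 0) := by
    have h01 : ∫ s in ({0, 1} : Set unitInterval), f (s, 0) ∂ξ =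
        ξ.real {0} * f (0, 0) + ξ.real {1} * f (1, 0) := by
      rw [Set.insert_eq, setIntegral_union (by simp) (measurableSet_singleton _)
        hgi.integrableOn hgi.integrableOn, integral_singleton, integral_singleton]
      rfl
    have := integral_add_compl (μ := ξ) (s := ({0, 1} : Set unitInterval))
      (Set.toFinite _).measurableSet hgi
    linarith
  have e2 : ∫ t, f (0, t) ∂η' =
      b * (∫ t, f (0, t) * (1 / (t : ℝ)) ∂η) - b * η.real {1} * f (0, 1) := by
    have h1 : ∫ t, f (0, t) ∂η' =
        ∫ t in ({1} : Set unitInterval)ᶜ, b * (f (0, t) * (1 / (t : ℝ))) ∂η := by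
      rw [hη', integral_withDensity_eq_integral_toReal_smul (by fun_prop)
        (Filter.Eventually.of_forall fun t => ENNReal.ofReal_lt_top)]
      refine integral_congr_ae (Filter.Eventually.of_forall fun t => ?_)
      have : 0 ≤ 1 / (t : ℝ) := one_div_nonneg.2 t.2.1
      simp only [ENNReal.toReal_ofReal (mul_nonneg hb this), smul_eq_mul]
      ring
    have h2 : ∫ t in ({1} : Set unitInterval), f (0, t) * (1 / (t : ℝ)) ∂η =
        η.real {1} * f (0, 1) := by
      rw [integral_singleton]; simp
    have := integral_add_compl (μ := η) (measurableSet_singleton (1 : unitInterval)) hhi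
    rw [h1, integral_const_mul, ← this, h2]
    ring
  have e3 : ∫ t, (f (0, t) - f (0, 0)) * (1 / (t : ℝ)) ∂η =
      ∫ t, f (0, t) * (1 / (t : ℝ)) ∂η - f (0, 0) * ∫ t, 1 / (t : ℝ) ∂η := by
    rw [← integral_const_mul, ← integral_sub hhi (hint.const_mul _)]
    simp only [sub_mul]
  rw [integral_add_measure ((hi _).add_measure (hi _))
      ((((hid _ _).add_measure (hid _ _)).add_measure (hid _ _)).add_measure (hid _ _)),
    integral_add_measure (hi _) (hi _),
    integral_add_measure (((hid _ _).add_measure (hid _ _)).add_measure (hid _ _)) (hid _ _),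
    integral_add_measure ((hid _ _).add_measure (hid _ _)) (hid _ _),
    integral_add_measure (hid _ _) (hid _ _),
    hdirac _ (sub_nonneg.2 hq), hdirac _ (mul_nonneg hb (sub_nonneg.2 hη)),
    hdirac _ (mul_nonneg hb hA), hdirac _ (sub_nonneg.2 hp),
    integral_map hm₁.aemeasurable hf.aestronglyMeasurable,
    integral_map hm₂.aemeasurable hf.aestronglyMeasurable, e1, e2, e3]
  ring

end TwoVarShift

/-! ### The criterion for measures on the unit interval -/

namespace TwoVarShift

lemma one_sub_pow_eq_sum_real (s : ℝ) (n : ℕ) :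
    (1 - s) ^ n = ∑ i ∈ Finset.range (n + 1), ((-1) ^ i * (n.choose i : ℝ)) * s ^ i := by
  rw [one_sub_pow_eq_sum]
  refine Finset.sum_congr rfl fun i _ => ?_
  rw [zsmul_eq_mul]; push_cast; rfl

lemma sum_neg_one_pow_mul_choose_succ (n : ℕ) :
    ∑ i ∈ Finset.range (n + 1), ((-1) ^ (i + 1) * ((n + 1).choose (i + 1) : ℝ)) = -1 := by
  have h := one_sub_pow_eq_sum_real 1 (n + 1)
  rw [Finset.sum_range_succ'] at h
  simp at h
  linarith

/-- The quotient of `(1 - t)ᵐ - 1` by `t`, expanded in powers of `t` and of `1 - t`. -/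
lemma sum_choose_succ_mul_pow_eq (t : ℝ) (m : ℕ) :
    ∑ j ∈ Finset.range m, ((-1) ^ (j + 1) * (m.choose (j + 1) : ℝ)) * t ^ j =
      -∑ i ∈ Finset.range m, (1 - t) ^ i := by
  rcases eq_or_ne t 0 with rfl | ht
  · cases m with
    | zero => simp
    | succ m => rw [Finset.sum_range_succ']; simp
  · refine mul_right_cancel₀ ht ?_
    have h1 := one_sub_pow_eq_sum_real t m
    rw [Finset.sum_range_succ'] at h1
    have h2 := geom_sum_mul (1 - t) m
    have h3 : (∑ j ∈ Finset.range m, ((-1) ^ (j + 1) * (m.choose (j + 1) : ℝ)) * t ^ j) * t =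
        ∑ j ∈ Finset.range m, ((-1) ^ (j + 1) * (m.choose (j + 1) : ℝ)) * t ^ (j + 1) := by
      rw [Finset.sum_mul]
      exact Finset.sum_congr rfl fun j _ => by ring
    rw [h3]
    simp only [pow_zero, Nat.choose_zero_right, Nat.cast_one, mul_one] at h1
    linarith

/-- An alternating double sum of a function that is constant off the coordinate axes. -/
lemma sum_sum_eq_of_flat (a b : ℕ → ℝ) (G : ℕ × ℕ → ℝ) {c : ℝ}
    (hG : ∀ i j, G (i + 1, j + 1) = c) (n m : ℕ) :
    ∑ i ∈ Finset.range (n + 1), ∑ j ∈ Finset.range (m + 1), a i * b j * G (i, j) =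
      b 0 * ∑ i ∈ Finset.range (n + 1), a i * G (i, 0) +
      a 0 * ∑ j ∈ Finset.range m, b (j + 1) * G (0, j + 1) +
      c * (∑ i ∈ Finset.range n, a (i + 1)) * ∑ j ∈ Finset.range m, b (j + 1) := by
  simp only [Finset.sum_range_succ' _ m, Finset.sum_add_distrib]
  rw [Finset.sum_range_succ' _ n]
  simp only [hG]
  have h1 : ∑ i ∈ Finset.range n, ∑ j ∈ Finset.range m, a (i + 1) * b (j + 1) * c =
      c * (∑ i ∈ Finset.range n, a (i + 1)) * ∑ j ∈ Finset.range m, b (j + 1) := by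
    rw [mul_assoc, Finset.sum_mul_sum, Finset.mul_sum]
    simp only [Finset.mul_sum]
    exact Finset.sum_congr rfl fun i _ => Finset.sum_congr rfl fun j _ => by ring
  have h2 : ∀ i, a i * b 0 * G (i, 0) = b 0 * (a i * G (i, 0)) := fun i => by ring
  simp only [h1, h2, mul_assoc (a 0), ← Finset.mul_sum, Finset.sum_range_succ' _ n]
  ring

/-- Integrating the binomial expansion of `(1 - s)ⁿ`. -/
lemma sum_mul_moment_eq_integral (ν : Measure unitInterval) [IsFiniteMeasure ν] {w : ℕ → ℝ}
    (hν : ∀ k : ℕ, ∫ t, (t : ℝ) ^ k ∂ν = moment w k) (n : ℕ) :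
    ∑ i ∈ Finset.range (n + 1), ((-1) ^ i * (n.choose i : ℝ)) * moment w i =
      ∫ t, (1 - (t : ℝ)) ^ n ∂ν := by
  simp_rw [one_sub_pow_eq_sum_real, ← hν]
  rw [integral_finsetSum _ fun i _ => integrable_of_continuous ν (by fun_prop)]
  simp_rw [integral_const_mul]

lemma sum_succ_mul_moment_eq_integral (ν : Measure unitInterval) [IsFiniteMeasure ν] {w : ℕ → ℝ}
    (hν : ∀ k : ℕ, ∫ t, (t : ℝ) ^ k ∂ν = moment w k) (m : ℕ) :
    ∑ j ∈ Finset.range m, ((-1) ^ (j + 1) * (m.choose (j + 1) : ℝ)) * moment w j =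
      -∫ t, ∑ i ∈ Finset.range m, (1 - (t : ℝ)) ^ i ∂ν := by
  rw [← integral_neg]
  simp_rw [← sum_choose_succ_mul_pow_eq, ← hν]
  rw [integral_finsetSum _ fun i _ => integrable_of_continuous ν (by fun_prop)]
  simp_rw [integral_const_mul]

namespace SFC

variable {α β : ℕ × ℕ → ℝ} {T₁ T₂ : ellTwo →L[ℂ] ellTwo} {ξ η : Measure unitInterval}
  [IsProbabilityMeasure ξ] [IsProbabilityMeasure η]

/-- Subnormality of `T₂` on the zeroth column. -/
lemma integral_geometric_sum_le_one (hT : SFC α β T₁ T₂)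
    (hη : ∀ k : ℕ, ∫ t, (t : ℝ) ^ k ∂η = moment (fun n => β (0, n + 1)) k) (m : ℕ) :
    β (0, 0) ^ 2 * ∫ t, ∑ i ∈ Finset.range m, (1 - (t : ℝ)) ^ i ∂η ≤ 1 := by
  have h := hT.subnormal_snd.isJointlySubnormal_one.sum_nonneg
    (ContinuousLinearMap.norm_id_le) hT.norm_snd_le (e (0, 0)) 0 m
  have h0 : ∀ j, ‖(T₂ ^ j) (e (0, 0))‖ ^ 2 = pathWeight α β (0, j) ^ 2 := fun j => by
    rw [← hT.isShift.norm_pow_apply_e 0 j]; rfl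
  simp only [zero_add, Finset.range_one, Finset.sum_singleton, pow_zero, Nat.choose_self,
    Nat.cast_one, mul_one, one_mul, one_apply_eq_self, h0] at h
  rw [Finset.sum_range_succ'] at h
  simp only [pathWeight_zero_fst_succ, mul_left_comm _ (β (0, 0) ^ 2)] at h
  rw [← Finset.mul_sum, sum_succ_mul_moment_eq_integral η hη] at h
  simp [pathWeight] at h
  linarith

/-- Positivity of `∫ (1 - s)ⁿ (1 - t)ᵐ`, in terms of the measures of the zeroth row and column. -/
lemma integral_geometric_sum_le (hT : SFC α β T₁ T₂) (hsub : IsJointlySubnormal T₁ T₂)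
    (hξ : ∀ k : ℕ, ∫ t, (t : ℝ) ^ k ∂ξ = moment (fun n => α (n, 0)) k)
    (hη : ∀ k : ℕ, ∫ t, (t : ℝ) ^ k ∂η = moment (fun n => β (0, n + 1)) k) (n m : ℕ) :
    β (0, 0) ^ 2 * ∫ t, ∑ i ∈ Finset.range (m + 1), (1 - (t : ℝ)) ^ i ∂η ≤
      ∫ s, (1 - (s : ℝ)) ^ (n + 1) ∂ξ + β (0, 0) ^ 2 * α (0, 1) ^ 2 := by
  have h := hsub.sum_nonneg hT.norm_fst_le hT.norm_snd_le (e (0, 0)) (n + 1) (m + 1)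
  simp only [hT.isShift.norm_pow_apply_e] at h
  rw [sum_sum_eq_of_flat (fun i => (-1) ^ i * ((n + 1).choose i : ℝ))
    (fun j => (-1) ^ j * ((m + 1).choose j : ℝ)) (fun k => pathWeight α β k ^ 2)
    (fun i j => by rw [hT.pathWeight_succ_succ]), sum_neg_one_pow_mul_choose_succ,
    sum_neg_one_pow_mul_choose_succ] at h
  simp only [pathWeight_zero_snd, pathWeight_zero_fst_succ, mul_left_comm _ (β (0, 0) ^ 2)] at h
  rw [← Finset.mul_sum, sum_mul_moment_eq_integral ξ hξ, sum_succ_mul_moment_eq_integral η hη] at h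
  simp only [pow_zero, Nat.choose_zero_right, Nat.cast_one, one_mul] at h
  linarith

lemma integrable_one_div_and_sq_le (hT : SFC α β T₁ T₂)
    (hη : ∀ k : ℕ, ∫ t, (t : ℝ) ^ k ∂η = moment (fun n => β (0, n + 1)) k) :
    η {0} = 0 ∧ Integrable (fun t : unitInterval => 1 / (t : ℝ)) η ∧
      α (0, 1) ^ 2 ≤ ∫ t, 1 / (t : ℝ) ∂η := by
  have hb : 0 < β (0, 0) ^ 2 := pow_pos (hT.isShift.beta_pos _) 2
  obtain ⟨h0, hint, -⟩ := invNorm_of_bounded_geometric_sums η (C := 1 / β (0, 0) ^ 2) fun m => by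
    rw [le_div_iff₀' hb]
    exact hT.integral_geometric_sum_le_one hη m
  refine ⟨h0, hint, ?_⟩
  have ha : α (0, 1) ^ 2 ≤ 1 := by simpa [moment] using hT.sq_le_moment_column 0
  refine ha.trans ?_
  have h1 : ∫ _t : unitInterval, (1 : ℝ) ∂η = 1 := by simp
  refine h1.symm.trans_le (integral_mono_ae (integrable_const _) hint ?_)
  filter_upwards [measure_eq_zero_iff_ae_notMem.1 h0] with t ht
  have hpos : 0 < (t : ℝ) := lt_of_le_of_ne t.2.1 fun h => ht (Subtype.ext h.symm)
  exact (one_le_div hpos).2 t.2.2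

/-- Since the moments of `ξ` tend to `ξ {1}`, contractivity of `T₂` bounds that atom below. -/
lemma mul_sq_le_real_singleton_one (hT : SFC α β T₁ T₂)
    (hξ : ∀ k : ℕ, ∫ t, (t : ℝ) ^ k ∂ξ = moment (fun n => α (n, 0)) k) :
    β (0, 0) ^ 2 * α (0, 1) ^ 2 ≤ ξ.real {1} :=
  ge_of_tendsto' ((tendsto_integral_pow ξ).comp (Filter.tendsto_add_atTop_nat 1)) fun k =>
    (hT.mul_sq_le_moment_row k).trans_eq (hξ _).symm

lemma sq_le_real_singleton_one (hT : SFC α β T₁ T₂)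
    (hη : ∀ k : ℕ, ∫ t, (t : ℝ) ^ k ∂η = moment (fun n => β (0, n + 1)) k) :
    α (0, 1) ^ 2 ≤ η.real {1} :=
  ge_of_tendsto' (tendsto_integral_pow η) fun k =>
    (hT.sq_le_moment_column k).trans_eq (hη k).symm

/-- Subnormality in terms of the atom of `ξ` at the origin. -/
theorem isJointlySubnormal_iff (hT : SFC α β T₁ T₂)
    (hξ : ∀ k : ℕ, ∫ t, (t : ℝ) ^ k ∂ξ = moment (fun n => α (n, 0)) k)
    (hη : ∀ k : ℕ, ∫ t, (t : ℝ) ^ k ∂η = moment (fun n => β (0, n + 1)) k) :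
    IsJointlySubnormal T₁ T₂ ↔
      β (0, 0) ^ 2 * (∫ t, 1 / (t : ℝ) ∂η - α (0, 1) ^ 2) ≤ ξ.real {0} := by
  have hb : 0 < β (0, 0) ^ 2 := pow_pos (hT.isShift.beta_pos _) 2
  obtain ⟨h0, hint, -⟩ := hT.integrable_one_div_and_sq_le hη
  constructor
  · intro hsub
    have hbound : ∀ m : ℕ, ∫ t, ∑ i ∈ Finset.range m, (1 - (t : ℝ)) ^ i ∂η ≤
        (ξ.real {0} + β (0, 0) ^ 2 * α (0, 1) ^ 2) / β (0, 0) ^ 2 := by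
      intro m
      cases m with
      | zero => simp only [Finset.range_zero, Finset.sum_empty, integral_zero]; positivity
      | succ m =>
        rw [le_div_iff₀' hb]
        have hlim := ((tendsto_integral_one_sub_pow ξ).comp
          (Filter.tendsto_add_atTop_nat 1)).add_const (β (0, 0) ^ 2 * α (0, 1) ^ 2)
        exact ge_of_tendsto' hlim fun n => hT.integral_geometric_sum_le hsub hξ hη n m
    have h := (invNorm_of_bounded_geometric_sums η hbound).2.2
    rw [le_div_iff₀' hb] at h
    linarith
  · intro hp
    have hq := hT.mul_sq_le_real_singleton_one hξ
    obtain ⟨μ, hμ, hf⟩ := exists_measure_unitSquare ξ η hb.le (sq_nonneg _) hq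
      (hT.sq_le_real_singleton_one hη) hint hp
    refine isJointlySubnormal_of_measure hT.isShift (pathWeight α β) hT.isShift.pathWeight_pos
      (hT.isShift.pathWeight_fst_succ hT.commute) (pathWeight_snd_succ α β) μ fun k => ?_
    rw [hf _ (by fun_prop)]
    obtain ⟨_ | i, _ | j⟩ := k
    · simp [pathWeight]
    · rw [pathWeight_zero_fst_succ, ← hη]
      have h1 : ∫ t : unitInterval, (t : ℝ) ^ (j + 1) * (1 / (t : ℝ)) ∂η =
          ∫ t : unitInterval, (t : ℝ) ^ j ∂η := by
        refine integral_congr_ae ?_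
        filter_upwards [measure_eq_zero_iff_ae_notMem.1 h0] with t ht
        have : (t : ℝ) ≠ 0 := fun h => ht (Subtype.ext h)
        rw [pow_succ, mul_assoc, mul_one_div_cancel this, mul_one]
      simp only [Set.Icc.coe_zero, Set.Icc.coe_one, pow_zero, one_mul, mul_one, one_pow, ne_eq,
        Nat.succ_ne_zero, not_false_eq_true, zero_pow, sub_zero, h1, integral_zero]
      ring
    · rw [pathWeight_zero_snd, ← hξ]
      simp
    · rw [hT.pathWeight_succ_succ]
      simp [mul_pow, mul_comm]

end SFC
end TwoVarShift

/-! ### The criterion in terms of `sBound` -/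

namespace TwoVarShift

/-- The first entry of the minimum asks for `y² a² ≤ q`, and the second for
`y² (C - a²) ≤ p`, with `C = ‖1/t‖`, also when `C = a²`. -/
lemma coe_le_sBound_iff {ξ η : Measure ℝ} {a y : ℝ} (ha : 0 < a) (hy : 0 < y)
    (hC : a ^ 2 ≤ invNorm η) :
    (y : EReal) ≤ sBound ξ η a ↔
      y ^ 2 * a ^ 2 ≤ ξ.real {1} ∧ y ^ 2 * (invNorm η - a ^ 2) ≤ ξ.real {0} := by
  rw [sBound, le_min_iff]
  refine and_congr ?_ ?_
  · rw [EReal.coe_le_coe_iff, Real.le_sqrt' hy, le_div_iff₀ (pow_pos ha 2)]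
  · split_ifs with h
    · simp [h]
    · have hpos : 0 < invNorm η - a ^ 2 := lt_of_le_of_ne (sub_nonneg.2 hC) (Ne.symm h)
      rw [EReal.coe_le_coe_iff, Real.le_sqrt' hy, le_div_iff₀ hpos]

end TwoVarShift
/-- Here `x n = α (n, 0)` and `y n = β (0, n)` are the weights of the `0`-th row and of the `0`-th
column, and `a = α (0, 1)`. The first three assertions say that the quantities in `s` make sense. -/
theorem theorem5p4 (α β : ℕ × ℕ → ℝ)
    (T₁ T₂ : TwoVarShift.ellTwo →L[ℂ] TwoVarShift.ellTwo)
    (hT : TwoVarShift.SFC α β T₁ T₂)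
    (x y : ℕ → ℝ) (a : ℝ)
    (hx : ∀ n, x n = α (n, 0)) (hy : ∀ n, y n = β (0, n)) (ha : a = α (0, 1))
    (ξ η₁ : Measure ℝ)
    (hξ : TwoVarShift.IsBergerMeasure x ξ)
    (hη₁ : TwoVarShift.IsBergerMeasure (fun n => y (n + 1)) η₁) :
    η₁ {0} = 0 ∧ Integrable (fun t : ℝ => 1 / t) η₁ ∧ a ^ 2 ≤ TwoVarShift.invNorm η₁ ∧
      (TwoVarShift.IsJointlySubnormal T₁ T₂ ↔
        ((y 0 : ℝ) : EReal) ≤ TwoVarShift.sBound ξ η₁ a) := by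
  obtain rfl : x = fun n => α (n, 0) := funext hx
  obtain rfl : y = fun n => β (0, n) := funext hy
  subst ha
  have hα : ∀ k, α k ≤ 1 := fun k => (hT.isShift.alpha_le_norm k).trans hT.norm_fst_le
  have hβ : ∀ k, β k ≤ 1 := fun k => (hT.isShift.beta_le_norm k).trans hT.norm_snd_le
  have := hξ.isProbabilityMeasure
  have := hη₁.isProbabilityMeasure
  obtain ⟨ξ', _, rfl⟩ := TwoVarShift.exists_map_coe_eq ξ
    (hξ.compl_unitInterval (fun _ => (hT.isShift.alpha_pos _).le) fun _ => hα _)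
  obtain ⟨η', _, rfl⟩ := TwoVarShift.exists_map_coe_eq η₁
    (hη₁.compl_unitInterval (fun _ => (hT.isShift.beta_pos _).le) fun _ => hβ _)
  have hemb : MeasurableEmbedding ((↑) : unitInterval → ℝ) :=
    MeasurableEmbedding.subtype_coe measurableSet_Icc
  have hξm : ∀ k : ℕ, ∫ t, (t : ℝ) ^ k ∂ξ' = TwoVarShift.moment (fun n => α (n, 0)) k :=
    fun k => by rw [← hξ.moments, hemb.integral_map]
  have hηm : ∀ k : ℕ, ∫ t, (t : ℝ) ^ k ∂η' = TwoVarShift.moment (fun n => β (0, n + 1)) k :=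
    fun k => by rw [← hη₁.moments, hemb.integral_map]
  have hpre : ∀ r : unitInterval, ((↑) : unitInterval → ℝ) ⁻¹' {(r : ℝ)} = {r} := fun r => by
    ext t; simp [Subtype.ext_iff]
  have hreal : ∀ r : unitInterval, (ξ'.map ((↑) : unitInterval → ℝ)).real {(r : ℝ)} =
      ξ'.real {r} := fun r => by
    rw [map_measureReal_apply hemb.measurable (measurableSet_singleton _), hpre]
  have hinv : TwoVarShift.invNorm (η'.map (↑)) = ∫ t, 1 / (t : ℝ) ∂η' := by
    rw [TwoVarShift.invNorm, hemb.integral_map]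
    refine integral_congr_ae (Filter.Eventually.of_forall fun t => ?_)
    exact Real.norm_of_nonneg (one_div_nonneg.2 t.2.1)
  obtain ⟨h0, hint, hC⟩ := hT.integrable_one_div_and_sq_le hηm
  rw [← hinv] at hC
  refine ⟨?_, hemb.integrable_map_iff.2 hint, hC, ?_⟩
  · rw [← h0, hemb.map_apply]
    exact congrArg _ (hpre 0)
  · rw [TwoVarShift.coe_le_sBound_iff (hT.isShift.alpha_pos _) (hT.isShift.beta_pos _) hC,
      hinv, hT.isJointlySubnormal_iff hξm hηm, ← hreal 0]
    have hq := hT.mul_sq_le_real_singleton_one hξm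
    rw [← hreal 1] at hq
    exact (and_iff_right hq).symm
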